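/- **Setting.** Let $\mathcal A$ be a finite set of base arms and $\mathcal I$ a nonempty family of subsets of $\mathcal A$ (the feasible super-arms). For $\theta\in\mathbb R^{\mathcal A}$ and $a\subseteq\mathcal A$ put $f_\theta(a)=\sum_{i\in a}\theta_i$. The true mean rewards $\theta^*_i$ ($i\in\mathcal A$) are independent with $\theta^*_i\sim\mathcal N(\mu_{i,0},\varsigma_{i,0}^2)$, $\varsigma_{i,0}^2>0$. Given $\theta^*$, every play of base arm $i$ yields an independent reward with law $\mathcal N(\theta^*_i,\sigma_i^2)$, where $\sigma_i^2>0$ is known. **Algorithm (Batched Thompson Sampling).** The horizon is $T=BK$: $B$ batches of $K$ rounds each. Before round $1$ every base arm is played once; these initial plays are observed, enter the posterior, and are not counted in the regret. In each round $t$ of batch $b$, sample (with fresh independent randomness) $\tilde\theta_i\sim\mathcal N(\mu_i,\varsigma_i^2)$ independently for all $i\in\mathcal A$, where $\mathcal N(\mu_i,\varsigma_i^2)$ is the posterior of $\theta^*_i$ given the initial plays and all rewards observed in batches $1,\dots,b-1$; then play $a_t\in\arg\max_{a\in\mathcal I}f_{\tilde\theta}(a)$. The rewards of all base arms in the super-arms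 played during batch $b$ are observed at the end of the batch, and each observation $r$ of base arm $i$ updates the posterior parameters by $$\varsigma_i^2\leftarrow\Big(\tfrac1{\varsigma_i^2}+\tfrac1{\sigma_i^2}\Big)^{-1},\qquad \mu_i\leftarrow\varsigma_{i,\mathrm{new}}^2\Big(\tfrac{\mu_i}{\varsigma_{i,\mathrm{old}}^2}+\tfrac{r}{\sigma_i^2}\Big).$$ **Theorem.** Assume $\sigma_i^2\le 1$ for all $i\in\mathcal A$ and $T\ge|\mathcal A|$. Then the regret $\sum_{t=1}^T\big(\max_{a\in\mathcal I}f_{\theta^*}(a)-f_{\theta^*}(a_t)\big)$ is integrable, and the Bayesian regret $$\mathrm{BayesRegret}(T)=\mathbb E\Big[\sum_{t=1}^T\big(\max_{a\in\mathcal I}f_{\theta^*}(a)-f_{\theta^*}(a_t)\big)\Big]$$ (expectation over the prior, the rewards and the sampling) satisfies $$\mathrm{BayesRegret}(T)\le 4+4\sqrt{8\log T}\,\big(|\mathcal A|K+|\mathcal A|\sqrt T\big)$$ (with the convention $\log 0=0$). In particular $\mathrm{BayesRegret}(T)=\tilde{\mathcal O}(|\mathcal A|K+|\mathcal A|\sqrt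 T)$ with a universal constant: for $T\ge2$, $$\mathrm{BayesRegret}(T)\le 16\sqrt{\log T}\,\big(|\mathcal A|K+|\mathcal A|\sqrt T\big).$$ -/

import Mathlib

open MeasureTheory ProbabilityTheory
open scoped NNReal

/-- A Gaussian combinatorial semi-bandit with base arms `A`: a nonempty family of feasible
super-arms, independent priors `θ i ∼ N(priorMean i, priorVar i)` on the mean rewards, and rewards
`N(θ i, noiseVar i)` for the base arms. -/
structure SemiBandit (A : Type*) where
  feasible : Finset (Finset A)
  feasible_nonempty : feasible.Nonempty
  priorMean : A → ℝ
  priorVar : A → ℝ≥0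
  noiseVar : A → ℝ≥0

/-- Labels of the independent primitive random draws. The `k`-th round of the `b`-th batch
(both counted from `0`) is round `t = b * K + k + 1`.
* `prior i`: the true mean reward of base arm `i`;
* `initial i`: the reward noise in the initial play of base arm `i`;
* `reward b k i`: the reward noise of base arm `i` in round `k` of batch `b`;
* `sample b k i`: the standard normal variable from which the posterior sample for base arm `i`
  is formed in round `k` of batch `b`. -/
inductive Draw (A : Type*) where
  | prior (i : A)
  | initial (i : A)
  | reward (b k : ℕ) (i : A)
  | sample (b k : ℕ) (i : A)

/-- Mean and variance of the (Gaussian, independent over the base arms) belief about the mean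
reward of each base arm. -/
abbrev Belief (A : Type*) := A → ℝ × ℝ

/-- Expected reward `f_θ(a)` of the super-arm `a` under the mean reward vector `θ`. -/
def superArmReward {A : Type*} (θ : A → ℝ) (a : Finset A) : ℝ := ∑ i ∈ a, θ i

namespace SemiBandit

variable {A : Type*}

/-- `argmax` selects, measurably, a feasible super-arm of maximal reward. -/
structure IsArgmax (M : SemiBandit A) (argmax : (A → ℝ) → Finset A) : Prop where
  mem : ∀ θ, argmax θ ∈ M.feasible
  le : ∀ θ, ∀ a ∈ M.feasible, superArmReward θ a ≤ superArmReward θ (argmax θ)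
  measurable : ∀ a, MeasurableSet {θ | argmax θ = a}

/-- The law of each primitive draw. -/
noncomputable def drawLaw (M : SemiBandit A) : Draw A → Measure ℝ
  | .prior i => gaussianReal (M.priorMean i) (M.priorVar i)
  | .initial i => gaussianReal 0 (M.noiseVar i)
  | .reward _ _ i => gaussianReal 0 (M.noiseVar i)
  | .sample _ _ _ => gaussianReal 0 1

instance (M : SemiBandit A) (d : Draw A) : IsProbabilityMeasure (M.drawLaw d) := by
  cases d <;> unfold drawLaw <;> infer_instance

/-- The joint law of all primitive draws, which are independent. -/
noncomputable def law (M : SemiBandit A) : Measure (Draw A → ℝ) :=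
  Measure.infinitePi M.drawLaw

/-- The true mean reward vector. -/
def trueMean (ω : Draw A → ℝ) : A → ℝ := fun i => ω (.prior i)

/-- The rewards in the initial play of all base arms: `N(θ i, noiseVar i)` given `θ`. -/
def initialReward (ω : Draw A → ℝ) : A → ℝ := fun i => trueMean ω i + ω (.initial i)

/-- The rewards of the base arms in round `k` of batch `b`: `N(θ i, noiseVar i)` given `θ`. -/
def reward (b k : ℕ) (ω : Draw A → ℝ) : A → ℝ := fun i => trueMean ω i + ω (.reward b k i)

/-- The prior belief. -/
def priorBelief (M : SemiBandit A) : Belief A := fun i => (M.priorMean i, M.priorVar i)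

/-- Conjugate Gaussian update of the belief after the base arms in `a` were played with
rewards `r i`, `i ∈ a`; the values `r i` for `i ∉ a` are not used (semi-bandit feedback). -/
noncomputable def update [DecidableEq A] (M : SemiBandit A) (a : Finset A) (r : A → ℝ)
    (p : Belief A) : Belief A := fun i =>
  if i ∈ a then
    let v : ℝ := (1 / (p i).2 + 1 / (M.noiseVar i : ℝ))⁻¹
    (v * ((p i).1 / (p i).2 + r i / (M.noiseVar i : ℝ)), v)
  else p i

/-- The sample in round `k` of batch `b` from the product of the normal distributions with the
means and variances given by the belief `p`. -/
noncomputable def sampleFrom (p : Belief A) (b k : ℕ) (ω : Draw A → ℝ) : A → ℝ :=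
  fun i => (p i).1 + √(p i).2 * ω (.sample b k i)

/-- The belief available to the algorithm during batch `b`: the posterior given the initial plays
and all plays in the earlier batches. During a batch (of size `K`) the belief is not changed; at
its end it is updated with all rewards observed in the batch. -/
noncomputable def posterior [Fintype A] [DecidableEq A] (M : SemiBandit A)
    (argmax : (A → ℝ) → Finset A) (K : ℕ) (ω : Draw A → ℝ) : ℕ → Belief A
  | 0 => M.update Finset.univ (initialReward ω) M.priorBelief
  | b + 1 =>
    let p := posterior M argmax K ω b
    (List.range K).foldl (fun q k => M.update (argmax (sampleFrom p b k ω)) (reward b k ω) q) p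

/-- The super-arm played by batched Thompson sampling in round `k` of batch `b`. -/
noncomputable def action [Fintype A] [DecidableEq A] (M : SemiBandit A)
    (argmax : (A → ℝ) → Finset A) (K b k : ℕ) (ω : Draw A → ℝ) : Finset A :=
  argmax (sampleFrom (M.posterior argmax K ω b) b k ω)

/-- The largest expected reward `f_θ(a*)` of a feasible super-arm. -/
noncomputable def optimalReward (M : SemiBandit A) (θ : A → ℝ) : ℝ :=
  M.feasible.sup' M.feasible_nonempty (superArmReward θ)

/-- The cumulative regret over `B` batches of `K` rounds each. -/
noncomputable def regret [Fintype A] [DecidableEq A] (M : SemiBandit A)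
    (argmax : (A → ℝ) → Finset A) (B K : ℕ) (ω : Draw A → ℝ) : ℝ :=
  ∑ b ∈ Finset.range B, ∑ k ∈ Finset.range K,
    (M.optimalReward (trueMean ω) - superArmReward (trueMean ω) (M.action argmax K b k ω))

/-- The Bayesian regret: the expected regret over the prior, the rewards and the sampling. -/
noncomputable def bayesRegret [Fintype A] [DecidableEq A] (M : SemiBandit A)
    (argmax : (A → ℝ) → Finset A) (B K : ℕ) : ℝ :=
  ∫ ω, M.regret argmax B K ω ∂M.law

end SemiBandit

/-! Thompson sampling matches probabilities: given what is known at the start of a batch, the sample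
and the true mean vector have the same law, so the optimal reward and the sample's value at the
played super-arm have equal expectations. The sample uses fresh randomness, so learning it, and
hence the action, leaves the posterior of the true means unchanged. The expected regret of a round
is therefore exactly the expectation of the sum of `ς_i * z_i` over the played arms, with `z_i`
standard normal (`integral_regret_round`). No confidence sets are needed.

Since `0 ≤ ς_i ≤ 1`, each term is at most `L * ς_i + exp ((L + 1) * (z_i - L))`, and the exponential
has expectation `exp ((1 - L ^ 2) / 2)`. Each play raises the precision by at least `1`, so `ς_i ≤ 1
/ √(1 + n_i)`, with `n_i` counting the plays in earlier batches. Summed over the plays of one arm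
this gives at most `K + 2 * √T` (`sum_div_sqrt_le`); batching costs only the additive `K`. The
choice `L = √(8 log T)` finishes the proof.

That the beliefs are posteriors is proved without conditional distributions. `IsPosterior` says that
replacing the true means by a redraw from the belief preserves the integral of every nonnegative
test function of mean, context and belief. This survives independent information and conjugate
updates; the latter reduces, arm by arm, to rotation invariance of the planar Gaussian
(`map_gaussian_conjugate_update`). -/

/-! ### One-dimensional Gaussians: conjugacy through rotation, and an exponential moment. -/

section RealGaussian

/-- The standard Gaussian measure on the plane is invariant under rotations. -/
lemma map_rotation_gaussianReal_prod {c s : ℝ} (h : c ^ 2 + s ^ 2 = 1) :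
    ((gaussianReal 0 1).prod (gaussianReal 0 1)).map
        (fun x : ℝ × ℝ => (c * x.1 + s * x.2, -s * x.1 + c * x.2)) =
      (gaussianReal 0 1).prod (gaussianReal 0 1) := by
  -- The rotation angle is the argument of the unit complex number `c + s * I`.
  have hz : ‖(⟨c, s⟩ : ℂ)‖ = 1 := by
    rw [Complex.norm_def, Complex.normSq_mk, ← pow_two, ← pow_two, h, Real.sqrt_one]
  have hne : (⟨c, s⟩ : ℂ) ≠ 0 := by
    rw [← norm_ne_zero_iff, hz]; exact one_ne_zero
  have key := IsGaussian.map_rotation_eq_self (μ := gaussianReal 0 1)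
    (by simp [integral_id_gaussianReal]) (Complex.arg ⟨c, s⟩)
  convert key using 2
  ext x
  · simp [ContinuousLinearMap.rotation_apply, Complex.cos_arg hne, Complex.sin_arg, hz]
  · simp [ContinuousLinearMap.rotation_apply, Complex.cos_arg hne, Complex.sin_arg, hz]

lemma gaussianReal_eq_map_sqrt_mul (s : ℝ≥0) :
    gaussianReal 0 s = (gaussianReal 0 1).map (fun x => √s * x) := by
  rw [gaussianReal_map_const_mul]
  congr 1
  · simp
  · ext; simp

lemma gaussianReal_eq_map_add_sqrt_mul (m : ℝ) (s : ℝ≥0) :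
    gaussianReal m s = (gaussianReal 0 1).map (fun x => m + √s * x) := by
  have : (fun x : ℝ => m + √s * x) = (fun x => m + x) ∘ (fun x => √s * x) := rfl
  rw [this, ← Measure.map_map (by fun_prop) (by fun_prop), ← gaussianReal_eq_map_sqrt_mul,
    gaussianReal_map_const_add, zero_add]

/-- Conjugacy of the Gaussian family: for a mean `m + √v W` observed with independent noise of
variance `s`, the joint law of the mean and of the updated belief is the one obtained by drawing
the mean afresh from the updated belief. -/
lemma map_gaussian_conjugate_update (m : ℝ) {v : ℝ} (hv : 0 < v) {s : ℝ≥0} (hs : 0 < s) :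
    ((gaussianReal 0 1).prod (gaussianReal 0 s)).map
        (fun x : ℝ × ℝ => (m + √v * x.1,
          ((1 / v + 1 / (s : ℝ))⁻¹ * (m / v + (m + √v * x.1 + x.2) / s),
            (1 / v + 1 / (s : ℝ))⁻¹))) =
      (((gaussianReal 0 1).prod (gaussianReal 0 s)).prod (gaussianReal 0 1)).map
        (fun y : (ℝ × ℝ) × ℝ =>
          ((1 / v + 1 / (s : ℝ))⁻¹ * (m / v + (m + √v * y.1.1 + y.1.2) / s) +
              √((1 / v + 1 / (s : ℝ))⁻¹) * y.2,
            ((1 / v + 1 / (s : ℝ))⁻¹ * (m / v + (m + √v * y.1.1 + y.1.2) / s),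
              (1 / v + 1 / (s : ℝ))⁻¹))) := by
  set γ := gaussianReal 0 1
  have hs' : (0 : ℝ) < s := hs
  have hN : γ.prod (gaussianReal 0 s) = (γ.prod γ).map (Prod.map id (fun x => √s * x)) := by
    rw [gaussianReal_eq_map_sqrt_mul s, ← Measure.map_prod_map _ _ (by fun_prop) (by fun_prop),
      Measure.map_id]
  set v' := (1 / v + 1 / (s : ℝ))⁻¹ with hv'
  have hv'e : v' = v * s / (v + s) := by
    rw [hv']; field_simp; ring
  set r := √(v + s) with hr
  have hr0 : 0 < r := Real.sqrt_pos.2 (by positivity)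
  have hr2 : r ^ 2 = v + s := Real.sq_sqrt (by positivity)
  have hv2 : √v ^ 2 = v := Real.sq_sqrt hv.le
  have hs2 : √(s : ℝ) ^ 2 = s := Real.sq_sqrt hs'.le
  have hsv' : √v' = √v * √s / r := by
    rw [hv'e, Real.sqrt_div (by positivity), Real.sqrt_mul hv.le]
  -- The second coordinate of `R` is the standardized observation `(√v * w + √s * e) / r`; the first
  -- is the orthogonal direction, the standardized posterior error. Mean and updated belief are a
  -- function `G` of these two independent normals.
  let R : ℝ × ℝ → ℝ × ℝ := fun x =>
    (√s / r * x.1 + -(√v / r) * x.2, -(-(√v / r)) * x.1 + √s / r * x.2)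
  have hR : (γ.prod γ).map R = γ.prod γ := by
    apply map_rotation_gaussianReal_prod
    rw [neg_sq, div_pow, div_pow, hv2, hs2, hr2]
    field_simp
    ring
  have hRm : Measurable R := by fun_prop
  let G : ℝ × ℝ → ℝ × ℝ × ℝ := fun z =>
    (m + v / r * z.2 + √v' * z.1, (m + v / r * z.2, v'))
  have hGm : Measurable G := by fun_prop
  have hmean : ∀ w e : ℝ, v' * (m / v + (m + √v * w + √s * e) / s) = m + v / r * (R (w, e)).2 := by
    intro w e
    have : v / r * (R (w, e)).2 = v * (√v * w + √s * e) / r ^ 2 := by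
      simp only [R]; field_simp
    rw [this, hr2, hv'e]
    field_simp
    ring
  have hval : ∀ w e : ℝ, m + √v * w = m + v / r * (R (w, e)).2 + √v' * (R (w, e)).1 := by
    intro w e
    have h1 : v / r * (R (w, e)).2 + √v' * (R (w, e)).1 =
        (√v * w * (v + √s ^ 2) + (v - √v ^ 2) * √s * e) / r ^ 2 := by
      rw [hsv']; simp only [R]; field_simp; ring
    rw [add_assoc, h1, hr2, hs2, hv2]
    field_simp
    ring
  rw [hN, Measure.map_map (by fun_prop) (by fun_prop)]
  have hL : (fun x : ℝ × ℝ => (m + √v * x.1, (v' * (m / v + (m + √v * x.1 + x.2) / s), v'))) ∘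
      Prod.map id (fun x => √s * x) = G ∘ R := by
    ext ⟨w, e⟩ <;> simp only [Function.comp, Prod.map, id, G]
    · exact hval w e
    · exact hmean w e
  rw [hL, ← Measure.map_map hGm hRm, hR]
  have hU : (γ.prod γ).map (fun x => (R x).2) = γ := by
    have : (fun x => (R x).2) = Prod.snd ∘ R := rfl
    rw [this, ← Measure.map_map measurable_snd hRm, hR]
    simp
  have hprod : ((γ.prod γ).map (Prod.map id (fun x => √s * x))).prod γ =
      ((γ.prod γ).prod γ).map (Prod.map (Prod.map id (fun x => √s * x)) id) := by
    have := Measure.map_prod_map (γ.prod γ) γ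
      (f := Prod.map id (fun x => √(s : ℝ) * x)) (by fun_prop) measurable_id
    rwa [Measure.map_id] at this
  rw [hprod, Measure.map_map (by fun_prop) (by fun_prop)]
  -- After redrawing, the fresh normal `z` takes the place of the posterior error, while the
  -- observation enters only through the second coordinate of `R`.
  have hRR : (fun y : (ℝ × ℝ) × ℝ =>
      (v' * (m / v + (m + √v * y.1.1 + y.1.2) / s) + √v' * y.2,
        (v' * (m / v + (m + √v * y.1.1 + y.1.2) / s), v'))) ∘
      Prod.map (Prod.map id (fun x => √s * x)) id =
      (G ∘ Prod.swap) ∘ Prod.map (fun x => (R x).2) id := by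
    ext ⟨⟨w, e⟩, z⟩ <;> simp only [Function.comp, Prod.map, id, G, Prod.swap, hmean]
  rw [hRR, ← Measure.map_map (by fun_prop) (by fun_prop),
    ← Measure.map_prod_map _ _ (by fun_prop) (by fun_prop), hU, Measure.map_id,
    ← Measure.map_map hGm measurable_swap, Measure.prod_swap]

/-- This exponential serves as a smooth majorant of the excess over `L`. The value is the moment
generating function at `L + 1`: `(L + 1) ^ 2 / 2 - (L + 1) * L = (1 - L ^ 2) / 2`. -/
lemma integral_exp_mul_sub_gaussianReal (L : ℝ) :
    ∫ x, Real.exp ((L + 1) * (x - L)) ∂(gaussianReal 0 1) = Real.exp ((1 - L ^ 2) / 2) := by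
  have h := mgf_gaussianReal (p := gaussianReal 0 1) (X := fun x : ℝ => x) (μ := 0) (v := 1)
    (by simp) (L + 1)
  simp only [mgf] at h
  simp_rw [mul_sub, Real.exp_sub, integral_div, h]
  rw [← Real.exp_sub]
  congr 1
  simp
  ring

end RealGaussian

/-- If `X` and `Y` are independent, an expectation over both may be computed by averaging over
the law of `Y` first. -/
lemma ProbabilityTheory.IndepFun.lintegral_comp_eq {Ω E F : Type*} {mΩ : MeasurableSpace Ω}
    [MeasurableSpace E] [MeasurableSpace F] {P : Measure Ω} [IsFiniteMeasure P]
    {X : Ω → E} {Y : Ω → F} (h : IndepFun X Y P) (hX : Measurable X) (hY : Measurable Y)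
    {ρ : Measure F} (hρ : P.map Y = ρ) {G : E × F → ENNReal} (hG : Measurable G) :
    ∫⁻ ω, G (X ω, Y ω) ∂P = ∫⁻ ω, ∫⁻ y, G (X ω, y) ∂ρ ∂P := by
  subst hρ
  rw [← lintegral_map (μ := P) hG (hX.prodMk hY),
    (indepFun_iff_map_prod_eq_prod_map_map hX.aemeasurable hY.aemeasurable).1 h,
    lintegral_prod _ hG.aemeasurable,
    lintegral_map (f := fun x => ∫⁻ y, G (x, y) ∂(P.map Y)) hG.lintegral_prod_right' hX]

namespace SemiBandit

variable {A : Type*}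

/-! ### Conjugate update of a whole belief vector, for a fixed set of played arms. -/

section Conjugacy

/-- The mean reward vector obtained from the belief `p` and the standardized vector `w`. -/
noncomputable def beliefPoint (p : Belief A) (w : A → ℝ) : A → ℝ :=
  fun i => (p i).1 + √(p i).2 * w i

@[fun_prop]
lemma measurable_beliefPoint :
    Measurable (fun x : Belief A × (A → ℝ) => beliefPoint x.1 x.2) := by
  refine measurable_pi_lambda _ fun i => ?_
  unfold beliefPoint
  fun_prop

/-- The law of a vector of independent standard normal variables. -/
noncomputable abbrev stdGaussian (A : Type*) [Fintype A] : Measure (A → ℝ) :=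
  Measure.pi fun _ => gaussianReal 0 1

/-- The law of the noise in one play of all base arms. -/
noncomputable abbrev noiseLaw [Fintype A] (M : SemiBandit A) : Measure (A → ℝ) :=
  Measure.pi fun i => gaussianReal 0 (M.noiseVar i)

lemma measurable_update [DecidableEq A] [Fintype A] (M : SemiBandit A) {C : Type*}
    [MeasurableSpace C] {a : C → Finset A} (ha : ∀ s, MeasurableSet {c | a c = s}) :
    Measurable (fun x : C × (A → ℝ) × Belief A => M.update (a x.1) x.2.1 x.2.2) := by
  refine measurable_pi_lambda _ fun i => ?_
  have hmem : MeasurableSet {c | i ∈ a c} := by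
    have : {c | i ∈ a c} = ⋃ s ∈ {s : Finset A | i ∈ s}, {c | a c = s} := by
      ext c; simp
    rw [this]
    exact MeasurableSet.biUnion (Set.to_countable _) fun s _ => ha s
  unfold update
  exact Measurable.ite (measurable_fst hmem) (by fun_prop) (by fun_prop)

lemma update_var_pos [DecidableEq A] (M : SemiBandit A) (hnoise : ∀ i, 0 < M.noiseVar i)
    (a : Finset A) (r : A → ℝ) {p : Belief A} (hp : ∀ i, 0 < (p i).2) (i : A) :
    0 < (M.update a r p i).2 := by
  have := hp i
  have hn : (0 : ℝ) < M.noiseVar i := hnoise i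
  unfold update
  split_ifs
  · dsimp only
    positivity
  · exact this

/-- After an update, redrawing the mean reward vector from the updated belief does not change the
joint law of the mean reward vector and the belief. -/
lemma map_beliefPoint_update [Fintype A] [DecidableEq A] (M : SemiBandit A)
    (hnoise : ∀ i, 0 < M.noiseVar i) (a : Finset A) {q : Belief A} (hq : ∀ i, 0 < (q i).2) :
    ((stdGaussian A).prod M.noiseLaw).map (fun x =>
        (beliefPoint q x.1, M.update a (beliefPoint q x.1 + x.2) q)) =
      (((stdGaussian A).prod M.noiseLaw).prod (stdGaussian A)).map (fun y =>
        (beliefPoint (M.update a (beliefPoint q y.1.1 + y.1.2) q) y.2,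
          M.update a (beliefPoint q y.1.1 + y.1.2) q)) := by
  let u : A → ℝ → ℝ × ℝ := fun i r =>
    if i ∈ a then
      ((1 / (q i).2 + 1 / (M.noiseVar i : ℝ))⁻¹ * ((q i).1 / (q i).2 + r / (M.noiseVar i : ℝ)),
        (1 / (q i).2 + 1 / (M.noiseVar i : ℝ))⁻¹)
    else q i
  have hu : ∀ i, Measurable (u i) := fun i => by
    by_cases hi : i ∈ a
    · simp only [u, hi, if_true]; fun_prop
    · simp only [u, hi, if_false]; fun_prop
  let f : (i : A) → ℝ × ℝ → ℝ × ℝ × ℝ := fun i x =>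
    ((q i).1 + √(q i).2 * x.1, u i ((q i).1 + √(q i).2 * x.1 + x.2))
  let g : (i : A) → (ℝ × ℝ) × ℝ → ℝ × ℝ × ℝ := fun i y =>
    ((u i ((q i).1 + √(q i).2 * y.1.1 + y.1.2)).1 +
      √(u i ((q i).1 + √(q i).2 * y.1.1 + y.1.2)).2 * y.2,
      u i ((q i).1 + √(q i).2 * y.1.1 + y.1.2))
  have hf : ∀ i, Measurable (f i) := fun i => by
    have := hu i
    fun_prop
  have hg : ∀ i, Measurable (g i) := fun i => by
    have := hu i
    fun_prop
  have hfg : ∀ i, ((gaussianReal 0 1).prod (gaussianReal 0 (M.noiseVar i))).map (f i) =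
      (((gaussianReal 0 1).prod (gaussianReal 0 (M.noiseVar i))).prod
        (gaussianReal 0 1)).map (g i) := fun i => by
    by_cases hi : i ∈ a
    · simp only [f, g, u, hi, if_true]
      exact map_gaussian_conjugate_update _ (hq i) (hnoise i)
    -- An unplayed arm keeps its belief, and the old and fresh normals have the same marginal law.
    · simp only [f, g, u, hi, if_false]
      have h1 : (fun x : ℝ × ℝ => ((q i).1 + √(q i).2 * x.1, q i)) =
        (fun w => ((q i).1 + √(q i).2 * w, q i)) ∘ Prod.fst := rfl
      have h2 : (fun y : (ℝ × ℝ) × ℝ => ((q i).1 + √(q i).2 * y.2, q i)) =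
        (fun w => ((q i).1 + √(q i).2 * w, q i)) ∘ Prod.snd := rfl
      rw [h1, h2, ← Measure.map_map (by fun_prop) (by fun_prop),
        ← Measure.map_map (by fun_prop) (by fun_prop)]
      simp
  let S : (A → ℝ × ℝ × ℝ) → (A → ℝ) × Belief A := fun x => (fun i => (x i).1, fun i => (x i).2)
  have hS : Measurable S := by fun_prop
  -- Regrouping pairs of vectors into vectors of pairs turns both sides into product measures over
  -- the arms.
  have hE := measurePreserving_arrowProdEquivProdArrow ℝ ℝ A (fun _ => gaussianReal 0 1)
    (fun i => gaussianReal 0 (M.noiseVar i))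
  have hE' := measurePreserving_arrowProdEquivProdArrow (ℝ × ℝ) ℝ A
    (fun i => (gaussianReal 0 1).prod (gaussianReal 0 (M.noiseVar i))) (fun _ => gaussianReal 0 1)
  have hE'' := (hE.prod (MeasurePreserving.id (stdGaussian A))).comp hE'
  have hF := (measurable_update M (C := Unit) (a := fun _ => a) (by simp))
  have hu1 : ∀ r : A → ℝ, M.update a r q = fun i => u i (r i) := fun r => by
    ext i : 1
    by_cases hi : i ∈ a <;> simp [u, update, hi]
  have hF1 : Measurable (fun r : A → ℝ => M.update a r q) :=
    hF.comp (g := fun x : Unit × (A → ℝ) × Belief A => M.update a x.2.1 x.2.2)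
      (f := fun r => ((), r, q)) (by fun_prop)
  have hb : Measurable (beliefPoint q) :=
    measurable_beliefPoint.comp (f := fun w => (q, w)) (by fun_prop)
  rw [← hE.map_eq, Measure.map_map (by fun_prop) hE.measurable, hE.map_eq, ← hE''.map_eq,
    Measure.map_map _ hE''.measurable]
  · have h1 : (fun x : (A → ℝ) × (A → ℝ) =>
        (beliefPoint q x.1, M.update a (beliefPoint q x.1 + x.2) q)) ∘
        (MeasurableEquiv.arrowProdEquivProdArrow ℝ ℝ A) = S ∘ (fun x i => f i (x i)) := by
      ext x : 1
      simp only [Function.comp, hu1]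
      rfl
    have h2 : (fun y : ((A → ℝ) × (A → ℝ)) × (A → ℝ) =>
        (beliefPoint (M.update a (beliefPoint q y.1.1 + y.1.2) q) y.2,
          M.update a (beliefPoint q y.1.1 + y.1.2) q)) ∘
        (Prod.map (MeasurableEquiv.arrowProdEquivProdArrow ℝ ℝ A) id ∘
          (MeasurableEquiv.arrowProdEquivProdArrow (ℝ × ℝ) ℝ A)) =
        S ∘ (fun x i => g i (x i)) := by
      ext x : 1
      simp only [Function.comp, hu1]
      rfl
    have (i : A) : IsProbabilityMeasure
      (((gaussianReal 0 1).prod (gaussianReal 0 (M.noiseVar i))).map (f i)) :=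
      Measure.isProbabilityMeasure_map (hf i).aemeasurable
    have (i : A) : IsProbabilityMeasure
      ((((gaussianReal 0 1).prod (gaussianReal 0 (M.noiseVar i))).prod
        (gaussianReal 0 1)).map (g i)) :=
      Measure.isProbabilityMeasure_map (hg i).aemeasurable
    rw [h1, h2, ← Measure.map_map hS (by fun_prop), ← Measure.map_map hS (by fun_prop),
      Measure.pi_map_pi fun i => (hf i).aemeasurable,
      Measure.pi_map_pi fun i => (hg i).aemeasurable]
    simp_rw [hfg]
  · fun_prop

end Conjugacy

/-! ### Posteriors as a redrawing identity, and the operations preserving it. -/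

section Posterior

variable [Fintype A] {Ω : Type*} [MeasurableSpace Ω] {C D : Type*} [MeasurableSpace C]
  [MeasurableSpace D]

/-- Given `c` and `q`, the conditional law of the vector `θ` is the product of the normal
distributions with means and variances given by the belief `q`. -/
structure IsPosterior (P : Measure Ω) (θ : Ω → A → ℝ) (q : Ω → Belief A) (c : Ω → C) : Prop where
  measurable_mean : Measurable θ
  measurable_belief : Measurable q
  measurable_context : Measurable c
  var_pos : ∀ ω i, 0 < (q ω i).2
  lintegral_eq : ∀ G : (A → ℝ) × C × Belief A → ENNReal, Measurable G →
    ∫⁻ ω, G (θ ω, c ω, q ω) ∂P =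
      ∫⁻ ω, ∫⁻ w, G (beliefPoint (q ω) w, c ω, q ω) ∂(stdGaussian A) ∂P

namespace IsPosterior

variable {P : Measure Ω} {θ : Ω → A → ℝ} {q : Ω → Belief A} {c : Ω → C}

/-- Test functions already see context and belief jointly, so any function of both may become the
new context. This serves to record the belief as well as to forget obsolete information. -/
lemma map_context (h : IsPosterior P θ q c) {g : C × Belief A → D} (hg : Measurable g) :
    IsPosterior P θ q (fun ω => g (c ω, q ω)) where
  measurable_mean := h.measurable_mean
  measurable_belief := h.measurable_belief
  measurable_context := hg.comp (h.measurable_context.prodMk h.measurable_belief)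
  var_pos := h.var_pos
  lintegral_eq G hG :=
    h.lintegral_eq (fun x => G (x.1, g x.2, x.2.2)) (hG.comp (by fun_prop))

/-- Information that is independent of everything so far does not change the posterior. -/
lemma extend_context [IsFiniteMeasure P] (h : IsPosterior P θ q c) {Z : Ω → D}
    (hZ : Measurable Z) (hind : IndepFun (fun ω => (θ ω, c ω, q ω)) Z P) :
    IsPosterior P θ q (fun ω => (c ω, Z ω)) where
  measurable_mean := h.measurable_mean
  measurable_belief := h.measurable_belief
  measurable_context := h.measurable_context.prodMk hZ
  var_pos := h.var_pos
  lintegral_eq G hG := by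
    have hX : Measurable (fun ω => (θ ω, c ω, q ω)) :=
      h.measurable_mean.prodMk (h.measurable_context.prodMk h.measurable_belief)
    have hX' : Measurable (fun ω => (c ω, q ω)) :=
      h.measurable_context.prodMk h.measurable_belief
    have hind' : IndepFun (fun ω => (c ω, q ω)) Z P :=
      hind.comp (φ := Prod.snd) measurable_snd measurable_id
    have hG1 : Measurable (fun x : ((A → ℝ) × C × Belief A) × D =>
        G (x.1.1, (x.1.2.1, x.2), x.1.2.2)) := hG.comp (by fun_prop)
    have hG2 : Measurable (fun x : ((C × Belief A) × D) × (A → ℝ) =>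
        G (beliefPoint x.1.1.2 x.2, (x.1.1.1, x.1.2), x.1.1.2)) := hG.comp (by fun_prop)
    -- Integrate `Z` out by independence, redraw the mean, and exchange the redraw with `Z`.
    rw [hind.lintegral_comp_eq hX hZ rfl hG1,
      h.lintegral_eq (fun x => ∫⁻ z, G (x.1, (x.2.1, z), x.2.2) ∂(P.map Z))
        hG1.lintegral_prod_right',
      hind'.lintegral_comp_eq hX' hZ rfl hG2.lintegral_prod_right']
    refine lintegral_congr fun ω => ?_
    exact lintegral_lintegral_swap (f := fun w z => G (beliefPoint (q ω) w, (c ω, z), q ω))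
      (hG.comp (by fun_prop)).aemeasurable

/-- Updating the belief with the rewards of a set of base arms that was chosen on the basis of the
available information yields the posterior. -/
lemma update [DecidableEq A] [IsFiniteMeasure P] (h : IsPosterior P θ q c) {M : SemiBandit A}
    (hnoise : ∀ i, 0 < M.noiseVar i) {a : C → Finset A} (ha : ∀ s, MeasurableSet {x | a x = s})
    {ε : Ω → A → ℝ} (hε : Measurable ε) (hlaw : P.map ε = M.noiseLaw)
    (hind : IndepFun (fun ω => (θ ω, c ω, q ω)) ε P) :
    IsPosterior P θ (fun ω => M.update (a (c ω)) (fun i => θ ω i + ε ω i) (q ω)) c where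
  measurable_mean := h.measurable_mean
  measurable_belief := (measurable_update M ha).comp (h.measurable_context.prodMk
    ((h.measurable_mean.add hε).prodMk h.measurable_belief))
  measurable_context := h.measurable_context
  var_pos ω i := update_var_pos M hnoise _ _ (h.var_pos ω) i
  lintegral_eq G hG := by
    have hX : Measurable (fun ω => (θ ω, c ω, q ω)) :=
      h.measurable_mean.prodMk (h.measurable_context.prodMk h.measurable_belief)
    have hup : Measurable (fun x : ((A → ℝ) × C × Belief A) × (A → ℝ) =>
        M.update (a x.1.2.1) (x.1.1 + x.2) x.1.2.2) :=
      (measurable_update M ha).comp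
        (f := fun x : ((A → ℝ) × C × Belief A) × (A → ℝ) => (x.1.2.1, x.1.1 + x.2, x.1.2.2))
        (by fun_prop)
    have hG1 : Measurable (fun x : ((A → ℝ) × C × Belief A) × (A → ℝ) =>
        G (x.1.1, x.1.2.1, M.update (a x.1.2.1) (x.1.1 + x.2) x.1.2.2)) :=
      hG.comp (by fun_prop)
    have hG2 : Measurable (fun x : (((A → ℝ) × C × Belief A) × (A → ℝ)) × (A → ℝ) =>
        G (beliefPoint (M.update (a x.1.1.2.1) (x.1.1.1 + x.1.2) x.1.1.2.2) x.2, x.1.1.2.1,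
          M.update (a x.1.1.2.1) (x.1.1.1 + x.1.2) x.1.1.2.2)) :=
      hG.comp ((measurable_beliefPoint.comp
        ((hup.comp measurable_fst).prodMk measurable_snd)).prodMk
          ((by fun_prop : Measurable _).prodMk (hup.comp measurable_fst)))
    -- On both sides the noise is integrated out, then the true mean is redrawn from the old belief.
    -- What remains, for fixed `ω`, is `map_beliefPoint_update` with the constant arm set `a (c ω)`.
    have e1 := hind.lintegral_comp_eq hX hε hlaw hG1
    have e2 := hind.lintegral_comp_eq hX hε hlaw (hG2.lintegral_prod_right' (ν := stdGaussian A))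
    have e3 := h.lintegral_eq _ (hG1.lintegral_prod_right' (ν := M.noiseLaw))
    have e4 := h.lintegral_eq _
      ((hG2.lintegral_prod_right' (ν := stdGaussian A)).lintegral_prod_right' (ν := M.noiseLaw))
    refine e1.trans (e3.trans (Eq.trans ?_ (e2.trans e4).symm))
    refine lintegral_congr fun ω => ?_
    have key := M.map_beliefPoint_update hnoise (a (c ω)) (h.var_pos ω)
    have hb : Measurable (beliefPoint (q ω)) :=
      measurable_beliefPoint.comp (f := fun w => (q ω, w)) (by fun_prop)
    have hu : Measurable (fun x : (A → ℝ) × (A → ℝ) =>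
        M.update (a (c ω)) (beliefPoint (q ω) x.1 + x.2) (q ω)) :=
      hup.comp (f := fun x : (A → ℝ) × (A → ℝ) => ((beliefPoint (q ω) x.1, c ω, q ω), x.2))
        (by fun_prop)
    have hH : Measurable (fun x : (A → ℝ) × Belief A => G (x.1, c ω, x.2)) :=
      hG.comp (by fun_prop)
    have k := congrArg (fun ν => ∫⁻ x, G (x.1, c ω, x.2) ∂ν) key
    have hm1 : Measurable (fun x : (A → ℝ) × (A → ℝ) => (beliefPoint (q ω) x.1,
        M.update (a (c ω)) (beliefPoint (q ω) x.1 + x.2) (q ω))) := by fun_prop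
    have hm2 : Measurable (fun y : ((A → ℝ) × (A → ℝ)) × (A → ℝ) =>
        (beliefPoint (M.update (a (c ω)) (beliefPoint (q ω) y.1.1 + y.1.2) (q ω)) y.2,
          M.update (a (c ω)) (beliefPoint (q ω) y.1.1 + y.1.2) (q ω))) :=
      (measurable_beliefPoint.comp ((hu.comp measurable_fst).prodMk measurable_snd)).prodMk
        (hu.comp measurable_fst)
    rw [lintegral_map hH hm1, lintegral_map hH hm2] at k
    have k1 := lintegral_prod (μ := stdGaussian A) (ν := M.noiseLaw) _ (hH.comp hm1).aemeasurable
    have k2 := lintegral_prod (μ := (stdGaussian A).prod M.noiseLaw) (ν := stdGaussian A) _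
      (hH.comp hm2).aemeasurable
    have k3 := lintegral_prod (μ := stdGaussian A) (ν := M.noiseLaw) _
      ((hH.comp hm2).lintegral_prod_right' (ν := stdGaussian A)).aemeasurable
    exact k1.symm.trans (k.trans (k2.trans k3))

end IsPosterior

end Posterior

end SemiBandit

namespace SemiBandit

variable {A : Type*}

/-! ### Independence of primitive draws with disjoint labels, and the prior. -/

section Independence

/-- The σ-algebra generated by the primitive draws with labels in `S`. -/
abbrev drawSigma (S : Set (Draw A)) : MeasurableSpace (Draw A → ℝ) :=
  ⨆ d ∈ S, MeasurableSpace.comap (fun ω : Draw A → ℝ => ω d) inferInstance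

lemma drawSigma_mono {S T : Set (Draw A)} (h : S ⊆ T) : drawSigma S ≤ drawSigma T :=
  biSup_mono h

lemma measurable_drawSigma_eval {S : Set (Draw A)} {d : Draw A} (hd : d ∈ S) :
    Measurable[drawSigma S] (fun ω : Draw A → ℝ => ω d) :=
  (comap_measurable (fun ω : Draw A → ℝ => ω d)).mono
    (le_iSup₂ (f := fun (d : Draw A) (_ : d ∈ S) =>
      MeasurableSpace.comap (fun ω : Draw A → ℝ => ω d) inferInstance) d hd) le_rfl

lemma indepFun_of_disjoint_draws (M : SemiBandit A) {S T : Set (Draw A)} (hST : Disjoint S T)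
    {E F : Type*} [MeasurableSpace E] [MeasurableSpace F] {X : (Draw A → ℝ) → E}
    {Y : (Draw A → ℝ) → F} (hX : Measurable[drawSigma S] X) (hY : Measurable[drawSigma T] Y) :
    IndepFun X Y M.law := by
  have h : iIndepFun (fun (d : Draw A) (ω : Draw A → ℝ) => ω d) M.law :=
    iIndepFun_infinitePi (X := fun _ x => x) (fun _ => measurable_id)
  have hI := indep_iSup_of_disjoint (fun d => (measurable_pi_apply d).comap_le) h.iIndep hST
  rw [IndepFun_iff_Indep]
  exact indep_of_indep_of_le_left (indep_of_indep_of_le_right hI hY.comap_le) hX.comap_le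

instance (M : SemiBandit A) : IsProbabilityMeasure M.law := by
  unfold law; infer_instance

lemma law_map_draws [Fintype A] (M : SemiBandit A) {f : A → Draw A} (hf : Function.Injective f) :
    M.law.map (fun ω i => ω (f i)) = Measure.pi fun i => M.drawLaw (f i) := by
  rw [law, Measure.map_infinitePi_infinitePi_of_inj hf, Measure.infinitePi_eq_pi]

/-- The draws made before round `k` of batch `b`. -/
def past (b k : ℕ) : Set (Draw A) := {d | match d with
  | .prior _ => True
  | .initial _ => True
  | .reward b' k' _ => b' < b ∨ b' = b ∧ k' < k
  | .sample b' k' _ => b' < b ∨ b' = b ∧ k' < k}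

lemma past_mono (b : ℕ) {k l : ℕ} (h : k ≤ l) : (past b k : Set (Draw A)) ⊆ past b l := by
  rintro (i | i | ⟨b', k', i⟩ | ⟨b', k', i⟩) hd <;> simp only [past, Set.mem_ofPred_eq] at hd ⊢ <;>
    omega

lemma past_subset_past_succ (b k : ℕ) : (past b k : Set (Draw A)) ⊆ past (b + 1) 0 := by
  rintro (i | i | ⟨b', k', i⟩ | ⟨b', k', i⟩) hd <;> simp only [past, Set.mem_ofPred_eq] at hd ⊢ <;>
    omega

lemma measurable_drawSigma_range (f : A → Draw A) :
    Measurable[drawSigma (Set.range f)] (fun (ω : Draw A → ℝ) i => ω (f i)) :=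
  @measurable_pi_lambda _ _ _ (drawSigma _) _ _ fun i =>
    measurable_drawSigma_eval (Set.mem_range_self i)

lemma measurableSet_argmax_beliefPoint {M : SemiBandit A} {argmax : (A → ℝ) → Finset A}
    (hargmax : M.IsArgmax argmax) (s : Finset A) :
    MeasurableSet {x : Belief A × (A → ℝ) | argmax (beliefPoint x.1 x.2) = s} :=
  measurable_beliefPoint (hargmax.measurable s)

lemma measurable_trueMean_past (b k : ℕ) :
    Measurable[drawSigma (past b k)] (trueMean : (Draw A → ℝ) → A → ℝ) :=
  @measurable_pi_lambda _ _ _ (drawSigma _) _ _ fun i =>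
    measurable_drawSigma_eval (d := Draw.prior i) (by simp [past])

lemma law_map_trueMean [Fintype A] (M : SemiBandit A) :
    M.law.map trueMean = (stdGaussian A).map (beliefPoint M.priorBelief) := by
  have h := M.law_map_draws (f := Draw.prior) (fun _ _ h => by simpa using h)
  refine h.trans ?_
  have (i : A) : IsProbabilityMeasure
      ((gaussianReal 0 1).map (fun w => M.priorMean i + √(M.priorVar i : ℝ) * w)) :=
    Measure.isProbabilityMeasure_map (by fun_prop)
  have h2 := Measure.pi_map_pi (μ := fun _ : A => gaussianReal 0 1)
    (f := fun i w => M.priorMean i + √(M.priorVar i : ℝ) * w) (fun i => by fun_prop)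
  refine Eq.trans ?_ h2.symm
  congr 1
  ext1 i
  exact gaussianReal_eq_map_add_sqrt_mul _ _

lemma isPosterior_prior [Fintype A] {M : SemiBandit A} (hprior : ∀ i, 0 < M.priorVar i) :
    IsPosterior M.law trueMean (fun _ => M.priorBelief) (fun _ => ()) where
  measurable_mean := measurable_pi_lambda _ fun i => measurable_pi_apply _
  measurable_belief := measurable_const
  measurable_context := measurable_const
  var_pos _ i := hprior i
  lintegral_eq G hG := by
    have hm : Measurable (trueMean : (Draw A → ℝ) → A → ℝ) :=
      measurable_pi_lambda _ fun i => measurable_pi_apply _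
    have hb : Measurable (beliefPoint M.priorBelief) :=
      measurable_beliefPoint.comp (f := fun w => (M.priorBelief, w)) (by fun_prop)
    have hG' : Measurable (fun θ : A → ℝ => G (θ, (), M.priorBelief)) := hG.comp (by fun_prop)
    rw [lintegral_const, measure_univ, mul_one,
      ← lintegral_map (f := fun θ => G (θ, (), M.priorBelief)) hG' hm, law_map_trueMean,
      lintegral_map hG' hb]

end Independence

/-! ### The algorithm's beliefs are adapted and are posteriors. -/

section Beliefs

variable [Fintype A] [DecidableEq A]

/-- The belief after the plays of the first `k` rounds of batch `b` have been taken into account. -/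
noncomputable def runningBelief (M : SemiBandit A) (argmax : (A → ℝ) → Finset A) (K b k : ℕ)
    (ω : Draw A → ℝ) : Belief A :=
  (List.range k).foldl (fun q k => M.update (argmax (sampleFrom (M.posterior argmax K ω b) b k ω))
    (reward b k ω) q) (M.posterior argmax K ω b)

variable (M : SemiBandit A) (argmax : (A → ℝ) → Finset A) (K : ℕ)

lemma runningBelief_zero (b : ℕ) (ω : Draw A → ℝ) :
    M.runningBelief argmax K b 0 ω = M.posterior argmax K ω b := rfl

lemma runningBelief_succ (b k : ℕ) (ω : Draw A → ℝ) :
    M.runningBelief argmax K b (k + 1) ω =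
      M.update (M.action argmax K b k ω) (reward b k ω) (M.runningBelief argmax K b k ω) := by
  simp [runningBelief, List.range_succ, List.foldl_append, action]

lemma runningBelief_batch (b : ℕ) (ω : Draw A → ℝ) :
    M.runningBelief argmax K b K ω = M.posterior argmax K ω (b + 1) := rfl

variable {M argmax}

/-- Measurability at the start of the batch is a hypothesis so that this induction over rounds can
serve as the step of the induction over batches. -/
lemma measurable_runningBelief_of_posterior (hargmax : M.IsArgmax argmax) (b : ℕ)
    (h : Measurable[drawSigma (past b 0)] (fun ω => M.posterior argmax K ω b)) (k : ℕ) :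
    Measurable[drawSigma (past b k)] (M.runningBelief argmax K b k) := by
  induction k with
  | zero => exact h
  | succ k ih =>
    have ha := measurableSet_argmax_beliefPoint hargmax
    have hup := measurable_update M ha
    have h1 : Measurable[drawSigma (past b (k + 1))] (fun ω => M.posterior argmax K ω b) :=
      h.mono (drawSigma_mono (past_mono b (Nat.zero_le _))) le_rfl
    have h2 : Measurable[drawSigma (past b (k + 1))] (M.runningBelief argmax K b k) :=
      ih.mono (drawSigma_mono (past_mono b (Nat.le_succ k))) le_rfl
    have h3 : Measurable[drawSigma (past b (k + 1))]
        (fun (ω : Draw A → ℝ) i => ω (.sample b k i)) :=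
      @measurable_pi_lambda _ _ _ (drawSigma _) _ _ fun i =>
        measurable_drawSigma_eval (by simp [past])
    have h4 : Measurable[drawSigma (past b (k + 1))]
        (reward b k : (Draw A → ℝ) → A → ℝ) :=
      @measurable_pi_lambda _ _ _ (drawSigma _) _ _ fun i =>
        @Measurable.add _ _ _ _ (drawSigma _) _ _ _
          (measurable_drawSigma_eval (d := .prior i) (by simp [past]))
          (measurable_drawSigma_eval (d := .reward b k i) (by simp [past]))
    have h5 : M.runningBelief argmax K b (k + 1) = fun ω =>
        M.update (argmax (beliefPoint (M.posterior argmax K ω b) fun i => ω (.sample b k i)))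
          (reward b k ω) (M.runningBelief argmax K b k ω) :=
      funext fun ω => M.runningBelief_succ argmax K b k ω
    rw [h5]
    exact @Measurable.comp _ _ _ (drawSigma _) _ _ _ _ hup
      (@Measurable.prodMk _ (drawSigma _) _ _ _ _ _ _
        (@Measurable.prodMk _ (drawSigma _) _ _ _ _ _ _ h1 h3)
        (@Measurable.prodMk _ (drawSigma _) _ _ _ _ _ _ h4 h2))

lemma measurable_posterior_past (hargmax : M.IsArgmax argmax) (b : ℕ) :
    Measurable[drawSigma (past b 0)] (fun ω => M.posterior argmax K ω b) := by
  induction b with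
  | zero =>
    have hup := measurable_update M (C := Unit) (a := fun _ => Finset.univ) (by simp)
    have h4 : Measurable[drawSigma (past 0 0)] (initialReward : (Draw A → ℝ) → A → ℝ) :=
      @measurable_pi_lambda _ _ _ (drawSigma _) _ _ fun i =>
        @Measurable.add _ _ _ _ (drawSigma _) _ _ _
          (measurable_drawSigma_eval (d := .prior i) (by simp [past]))
          (measurable_drawSigma_eval (d := .initial i) (by simp [past]))
    exact @Measurable.comp _ _ _ (drawSigma _) _ _ _
      (fun ω => ((), initialReward ω, M.priorBelief)) hup
      (@Measurable.prodMk _ (drawSigma _) _ _ _ _ _ _ (@measurable_const _ _ _ (drawSigma _) _)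
        (@Measurable.prodMk _ (drawSigma _) _ _ _ _ _ _ h4
          (@measurable_const _ _ _ (drawSigma _) _)))
  | succ b ih =>
    exact (measurable_runningBelief_of_posterior K hargmax b ih K).mono
      (drawSigma_mono (past_subset_past_succ b K)) le_rfl

lemma measurable_runningBelief_past (hargmax : M.IsArgmax argmax) (b k : ℕ) :
    Measurable[drawSigma (past b k)] (M.runningBelief argmax K b k) :=
  measurable_runningBelief_of_posterior K hargmax b (measurable_posterior_past K hargmax b) k

/-- The beliefs of the algorithm are the posteriors of the true mean reward vector. -/
lemma isPosterior_posterior (hprior : ∀ i, 0 < M.priorVar i) (hnoise : ∀ i, 0 < M.noiseVar i)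
    (hargmax : M.IsArgmax argmax) (b : ℕ) :
    IsPosterior M.law trueMean (fun ω => M.posterior argmax K ω b) (fun _ => ()) := by
  induction b with
  | zero =>
    refine (isPosterior_prior hprior).update hnoise (a := fun _ => Finset.univ) (by simp)
      (ε := fun ω i => ω (.initial i)) (by fun_prop)
      (M.law_map_draws (f := Draw.initial) (fun _ _ h => by simpa using h)) ?_
    refine M.indepFun_of_disjoint_draws (S := Set.range Draw.prior)
      (T := Set.range Draw.initial) ?_ ?_ (measurable_drawSigma_range _)
    · rw [Set.disjoint_left]
      rintro _ ⟨i, rfl⟩ ⟨j, hj⟩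
      simp at hj
    · exact @Measurable.prodMk _ (drawSigma _) _ _ _ _ _ _ (measurable_drawSigma_range _)
        (@measurable_const _ _ _ (drawSigma _) _)
  | succ b ih =>
    -- The context carries the belief from the start of the batch, because all actions of the batch
    -- are computed from it and not from the running belief.
    have hk : ∀ k, IsPosterior M.law trueMean (M.runningBelief argmax K b k)
        (fun ω => M.posterior argmax K ω b) := by
      intro k
      induction k with
      | zero => exact ih.map_context (g := Prod.snd) measurable_snd
      | succ k ihk =>
        have hX : Measurable[drawSigma (past b k)] (fun ω => (trueMean ω,
            M.posterior argmax K ω b, M.runningBelief argmax K b k ω)) :=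
          @Measurable.prodMk _ (drawSigma _) _ _ _ _ _ _ (measurable_trueMean_past b k)
            (@Measurable.prodMk _ (drawSigma _) _ _ _ _ _ _
              ((measurable_posterior_past K hargmax b).mono
                (drawSigma_mono (past_mono b (Nat.zero_le _))) le_rfl)
              (measurable_runningBelief_past K hargmax b k))
        -- With the sampling noise in the context, the played super-arm is a function of the
        -- context, as the update requires.
        have h1 := ihk.extend_context (Z := fun (ω : Draw A → ℝ) i => ω (.sample b k i))
          (by fun_prop) (M.indepFun_of_disjoint_draws (S := past b k)
            (T := Set.range (Draw.sample b k)) (by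
              rw [Set.disjoint_left]
              rintro _ h ⟨i, rfl⟩
              simp [past] at h) hX (measurable_drawSigma_range _))
        have hX' : Measurable[drawSigma (past b k ∪ Set.range (Draw.sample b k))]
            (fun ω => (trueMean ω, (M.posterior argmax K ω b,
              fun i => ω (.sample b k i)), M.runningBelief argmax K b k ω)) := by
          have hX2 := hX.mono (drawSigma_mono
            (Set.subset_union_left (t := Set.range (Draw.sample b k)))) le_rfl
          have hZ2 := (measurable_drawSigma_range (Draw.sample b k : A → Draw A)).mono (drawSigma_mono
            (Set.subset_union_right (s := past b k))) le_rfl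
          exact @Measurable.comp _ _ _ (drawSigma _) _ _
            (fun x : ((A → ℝ) × Belief A × Belief A) × (A → ℝ) =>
              (x.1.1, (x.1.2.1, x.2), x.1.2.2)) _ (by fun_prop)
            (@Measurable.prodMk _ (drawSigma _) _ _ _ _ _ _ hX2 hZ2)
        have h2 := h1.update hnoise (measurableSet_argmax_beliefPoint hargmax)
          (ε := fun ω i => ω (.reward b k i)) (by fun_prop)
          (M.law_map_draws (f := Draw.reward b k) (fun _ _ h => by simpa using h))
          (M.indepFun_of_disjoint_draws (T := Set.range (Draw.reward b k)) (by
              rw [Set.disjoint_left]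
              rintro _ h ⟨i, rfl⟩
              simp [past] at h) hX' (measurable_drawSigma_range _))
        -- The sampling noise has done its work and is dropped from the context.
        have h3 := h2.map_context (g := fun x => x.1.1) (by fun_prop)
        convert h3 using 1
        exact funext fun ω => M.runningBelief_succ argmax K b k ω
    exact (hk K).map_context (g := fun _ => ()) measurable_const

end Beliefs

end SemiBandit

/-! ### The regret of a single round, and the decay of posterior variances. -/

namespace SemiBandit

variable {A : Type*}

lemma optimalReward_eq {M : SemiBandit A} {argmax : (A → ℝ) → Finset A}
    (hargmax : M.IsArgmax argmax) (θ : A → ℝ) :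
    M.optimalReward θ = superArmReward θ (argmax θ) :=
  le_antisymm (Finset.sup'_le _ _ fun a ha => hargmax.le θ a ha)
    (Finset.le_sup' _ (hargmax.mem θ))

lemma abs_superArmReward_le [Fintype A] (θ : A → ℝ) (a : Finset A) : |superArmReward θ a| ≤ ∑ i, |θ i| :=
  (Finset.abs_sum_le_sum_abs _ _).trans
    (Finset.sum_le_sum_of_subset_of_nonneg (Finset.subset_univ _) fun _ _ _ => abs_nonneg _)

lemma integrable_eval_law (M : SemiBandit A) (d : Draw A) :
    Integrable (fun ω => ω d) M.law := by
  have hd : Integrable (fun x : ℝ => x) (M.drawLaw d) := by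
    cases d <;> exact (memLp_id_gaussianReal 1).integrable le_rfl
  exact (measurePreserving_eval_infinitePi M.drawLaw d).integrable_comp_of_integrable hd

variable [Fintype A]

namespace IsPosterior

variable {Ω C : Type*} [MeasurableSpace Ω] [MeasurableSpace C]
  {P : Measure Ω} {θ : Ω → A → ℝ} {q : Ω → Belief A} {c : Ω → C}

/-- Passing from nonnegative test functions to an equality of laws makes signed integrands
accessible. -/
lemma map_eq [IsFiniteMeasure P] (h : IsPosterior P θ q c) :
    P.map (fun ω => (θ ω, c ω, q ω)) =
      (P.prod (stdGaussian A)).map (fun x => (beliefPoint (q x.1) x.2, c x.1, q x.1)) := by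
  have hθ := h.measurable_mean
  have hc := h.measurable_context
  have hq := h.measurable_belief
  have hm : Measurable (fun x : Ω × (A → ℝ) => (beliefPoint (q x.1) x.2, c x.1, q x.1)) := by
    exact (measurable_beliefPoint.comp (g := fun x : Belief A × (A → ℝ) => beliefPoint x.1 x.2)
      (f := fun x : Ω × (A → ℝ) => (q x.1, x.2)) (by fun_prop)).prodMk (by fun_prop)
  refine Measure.ext_of_lintegral _ fun G hG => ?_
  rw [lintegral_map hG (by fun_prop), lintegral_map hG hm]
  exact (h.lintegral_eq G hG).trans (lintegral_prod _ (hG.comp hm).aemeasurable).symm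

/-- A posterior sample has the same law as the true mean reward vector. -/
lemma map_sample_eq [IsFiniteMeasure P] (h : IsPosterior P θ q c) {Z : Ω → A → ℝ}
    (hZ : Measurable Z) (hlaw : P.map Z = stdGaussian A) (hind : IndepFun q Z P) :
    P.map (fun ω => beliefPoint (q ω) (Z ω)) = P.map θ := by
  have hθ := h.measurable_mean
  have hq := h.measurable_belief
  have hm : Measurable (fun ω => beliefPoint (q ω) (Z ω)) :=
    measurable_beliefPoint.comp (hq.prodMk hZ)
  refine Measure.ext_of_lintegral _ fun G hG => ?_
  rw [lintegral_map hG hm, lintegral_map hG hθ]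
  exact (hind.lintegral_comp_eq hq hZ hlaw (hG.comp measurable_beliefPoint)).trans
    (h.lintegral_eq (fun x => G x.1) (hG.comp measurable_fst)).symm

/-- On an event that is determined by the available information, the true mean reward and the
posterior mean have the same expectation. -/
lemma integral_indicator_sub_eq_zero [IsFiniteMeasure P] (h : IsPosterior P θ q c) {s : Set C}
    (hs : MeasurableSet s) (i : A) :
    ∫ ω, (c ⁻¹' s).indicator (fun ω => θ ω i - (q ω i).1) ω ∂P = 0 := by
  classical
  have hθ := h.measurable_mean
  have hc := h.measurable_context
  have hq := h.measurable_belief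
  have hm : Measurable (fun x : Ω × (A → ℝ) => (beliefPoint (q x.1) x.2, c x.1, q x.1)) := by
    exact (measurable_beliefPoint.comp (g := fun x : Belief A × (A → ℝ) => beliefPoint x.1 x.2)
      (f := fun x : Ω × (A → ℝ) => (q x.1, x.2)) (by fun_prop)).prodMk (by fun_prop)
  let F : (A → ℝ) × C × Belief A → ℝ := fun x => if x.2.1 ∈ s then x.1 i - (x.2.2 i).1 else 0
  have hF : Measurable F :=
    Measurable.ite ((measurable_fst.comp measurable_snd) hs) (by fun_prop) measurable_const
  have h1 : ∫ ω, (c ⁻¹' s).indicator (fun ω => θ ω i - (q ω i).1) ω ∂P =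
      ∫ ω, F (θ ω, c ω, q ω) ∂P := by
    refine integral_congr_ae (.of_forall fun ω => ?_)
    simp [F, Set.indicator_apply]
  rw [h1, ← integral_map (φ := fun ω => (θ ω, c ω, q ω)) (by fun_prop)
    hF.aestronglyMeasurable, h.map_eq, integral_map hm.aemeasurable hF.aestronglyMeasurable]
  -- After redrawing, the deviation is a factor known from context and belief times an independent
  -- centered normal, so the integral factors.
  have h2 : ∀ x : Ω × (A → ℝ), F (beliefPoint (q x.1) x.2, c x.1, q x.1) =
      (if c x.1 ∈ s then √(q x.1 i).2 else 0) * x.2 i := fun x => by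
    simp only [F, beliefPoint]
    split_ifs <;> simp
  simp_rw [h2]
  rw [integral_prod_mul (fun ω => if c ω ∈ s then √(q ω i).2 else 0) (fun w : A → ℝ => w i)]
  have h3 : ∫ w : A → ℝ, w i ∂(stdGaussian A) = 0 := by
    have := integral_map (μ := stdGaussian A) (φ := fun w => w i) (f := fun x : ℝ => x)
      (measurable_pi_apply i).aemeasurable (by fun_prop)
    rw [← this, (measurePreserving_eval _ i).map_eq]
    exact integral_id_gaussianReal
  rw [h3, mul_zero]

end IsPosterior

section Round

variable [DecidableEq A] {M : SemiBandit A} {argmax : (A → ℝ) → Finset A} (K : ℕ)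

lemma measurable_superArmReward_argmax (hargmax : M.IsArgmax argmax) {Ω : Type*}
    [MeasurableSpace Ω] {θ η : Ω → A → ℝ} (hθ : Measurable θ) (hη : Measurable η) :
    Measurable fun ω => superArmReward (θ ω) (argmax (η ω)) := by
  have : (fun ω => superArmReward (θ ω) (argmax (η ω))) =
      fun ω => ∑ i, if i ∈ argmax (η ω) then θ ω i else 0 := by
    ext ω; simp [superArmReward]
  rw [this]
  refine Finset.measurable_sum _ fun i _ => Measurable.ite ?_ (by fun_prop) measurable_const
  have : {ω | i ∈ argmax (η ω)} = ⋃ s ∈ {s : Finset A | i ∈ s}, {ω | argmax (η ω) = s} := by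
    ext c; simp
  rw [this]
  exact MeasurableSet.biUnion (Set.to_countable _) fun s _ => hη (hargmax.measurable s)

lemma integrable_superArmReward_argmax (hargmax : M.IsArgmax argmax) {Ω : Type*}
    [MeasurableSpace Ω] {P : Measure Ω} {θ η : Ω → A → ℝ} (hθ : Measurable θ) (hη : Measurable η)
    (hint : ∀ i, Integrable (fun ω => θ ω i) P) :
    Integrable (fun ω => superArmReward (θ ω) (argmax (η ω))) P :=
  (integrable_finsetSum Finset.univ fun i _ => (hint i).abs).mono'
    (measurable_superArmReward_argmax hargmax hθ hη).aestronglyMeasurable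
    (.of_forall fun _ => abs_superArmReward_le _ _)

/-- The posterior variances are at most the inverse of the number of plays. -/
lemma card_plays_le_inv_var (hprior : ∀ i, 0 < M.priorVar i) (hnoise : ∀ i, 0 < M.noiseVar i)
    (hnoise_le : ∀ i, M.noiseVar i ≤ 1) (ω : Draw A → ℝ) (i : A) (b : ℕ) :
    0 < (M.posterior argmax K ω b i).2 ∧
    1 + ∑ b' ∈ Finset.range b, ∑ k ∈ Finset.range K,
        (if i ∈ M.action argmax K b' k ω then (1 : ℝ) else 0) ≤
      1 / (M.posterior argmax K ω b i).2 := by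
  have hn : (0 : ℝ) < M.noiseVar i := hnoise i
  have hn1 : 1 ≤ 1 / (M.noiseVar i : ℝ) := by
    rw [le_div_iff₀ hn, one_mul]; exact_mod_cast hnoise_le i
  -- Precisions add: a play contributes `1 / noiseVar ≥ 1`. The leading `1` in the claim comes from
  -- the initial play.
  have step : ∀ (a : Finset A) (r : A → ℝ) (p : Belief A), 0 < (p i).2 →
      0 < (M.update a r p i).2 ∧
        1 / (p i).2 + (if i ∈ a then (1 : ℝ) else 0) ≤ 1 / (M.update a r p i).2 := by
    intro a r p hp
    unfold update
    split_ifs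
    · refine ⟨by dsimp only; positivity, ?_⟩
      simp only [one_div, inv_inv]
      rw [one_div] at hn1
      linarith
    · exact ⟨hp, by simp⟩
  induction b with
  | zero =>
    have h := step Finset.univ (initialReward ω) M.priorBelief (hprior i)
    refine ⟨h.1, ?_⟩
    have h2 := h.2
    have : 0 < 1 / (M.priorBelief i).2 := one_div_pos.2 (hprior i)
    simp only [Finset.mem_univ, if_true] at h2
    simp only [Finset.range_zero, Finset.sum_empty, add_zero]
    exact le_trans (by linarith) h2
  | succ b ih =>
    have hk : ∀ k, 0 < (M.runningBelief argmax K b k ω i).2 ∧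
        1 / (M.posterior argmax K ω b i).2 + ∑ k ∈ Finset.range k,
          (if i ∈ M.action argmax K b k ω then (1 : ℝ) else 0) ≤
        1 / (M.runningBelief argmax K b k ω i).2 := by
      intro k
      induction k with
      | zero => exact ⟨ih.1, by simp [runningBelief_zero]⟩
      | succ k ihk =>
        have h := step (M.action argmax K b k ω) (reward b k ω)
          (M.runningBelief argmax K b k ω) ihk.1
        rw [runningBelief_succ, Finset.sum_range_succ]
        exact ⟨h.1, by linarith [h.2, ihk.2]⟩
    have h := hk K
    rw [runningBelief_batch] at h
    rw [Finset.sum_range_succ]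
    exact ⟨h.1, by linarith [h.2, ih.2]⟩

lemma sqrt_var_le (hprior : ∀ i, 0 < M.priorVar i) (hnoise : ∀ i, 0 < M.noiseVar i)
    (hnoise_le : ∀ i, M.noiseVar i ≤ 1) (ω : Draw A → ℝ) (i : A) (b : ℕ) :
    √(M.posterior argmax K ω b i).2 ≤ 1 / √(1 + ∑ b' ∈ Finset.range b, ∑ k ∈ Finset.range K,
        (if i ∈ M.action argmax K b' k ω then (1 : ℝ) else 0)) := by
  obtain ⟨h1, h2⟩ := card_plays_le_inv_var (argmax := argmax) K hprior hnoise hnoise_le ω i b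
  have h0 : (0 : ℝ) ≤ ∑ b' ∈ Finset.range b, ∑ k ∈ Finset.range K,
      (if i ∈ M.action argmax K b' k ω then (1 : ℝ) else 0) :=
    Finset.sum_nonneg fun _ _ => Finset.sum_nonneg fun _ _ => by split_ifs <;> simp
  rw [one_div, ← Real.sqrt_inv]
  refine Real.sqrt_le_sqrt ?_
  rw [le_inv_comm₀ h1 (by linarith), ← one_div]
  exact h2

lemma sqrt_var_le_one (hprior : ∀ i, 0 < M.priorVar i) (hnoise : ∀ i, 0 < M.noiseVar i)
    (hnoise_le : ∀ i, M.noiseVar i ≤ 1) (ω : Draw A → ℝ) (i : A) (b : ℕ) :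
    √(M.posterior argmax K ω b i).2 ≤ 1 := by
  refine (sqrt_var_le (argmax := argmax) K hprior hnoise hnoise_le ω i b).trans ?_
  have h0 : (0 : ℝ) ≤ ∑ b' ∈ Finset.range b, ∑ k ∈ Finset.range K,
      (if i ∈ M.action argmax K b' k ω then (1 : ℝ) else 0) :=
    Finset.sum_nonneg fun _ _ => Finset.sum_nonneg fun _ _ => by split_ifs <;> simp
  rw [div_le_one (Real.sqrt_pos.2 (by linarith)), Real.one_le_sqrt]
  linarith

/-- The exploration bonus collected in one round by posterior sampling. -/
noncomputable def samplingBonus (M : SemiBandit A) (argmax : (A → ℝ) → Finset A) (K b k : ℕ)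
    (ω : Draw A → ℝ) : ℝ :=
  ∑ i, if i ∈ M.action argmax K b k ω then
    √(M.posterior argmax K ω b i).2 * ω (.sample b k i) else 0

/-- In each round the expected regret is integrable and equals the expected sampling bonus. -/
lemma integral_regret_round (hprior : ∀ i, 0 < M.priorVar i) (hnoise : ∀ i, 0 < M.noiseVar i)
    (hnoise_le : ∀ i, M.noiseVar i ≤ 1) (hargmax : M.IsArgmax argmax) (b k : ℕ) :
    Integrable (fun ω => M.optimalReward (trueMean ω) -
      superArmReward (trueMean ω) (M.action argmax K b k ω)) M.law ∧
    Integrable (M.samplingBonus argmax K b k) M.law ∧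
    ∫ ω, (M.optimalReward (trueMean ω) -
      superArmReward (trueMean ω) (M.action argmax K b k ω)) ∂M.law =
      ∫ ω, M.samplingBonus argmax K b k ω ∂M.law := by
  have hpost := isPosterior_posterior K hprior hnoise hargmax b
  have hθ := hpost.measurable_mean
  have hq := hpost.measurable_belief
  let Z : (Draw A → ℝ) → A → ℝ := fun ω i => ω (.sample b k i)
  have hZ : Measurable Z := by fun_prop
  have hlaw : M.law.map Z = stdGaussian A :=
    M.law_map_draws (f := Draw.sample b k) (fun _ _ h => by simpa using h)
  have hind : IndepFun (fun ω => (trueMean ω, (), M.posterior argmax K ω b)) Z M.law := by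
    refine M.indepFun_of_disjoint_draws (S := past b 0) (T := Set.range (Draw.sample b k)) ?_ ?_
      (measurable_drawSigma_range _)
    · rw [Set.disjoint_left]
      rintro _ h ⟨i, rfl⟩
      simp [past] at h
    · exact @Measurable.prodMk _ (drawSigma _) _ _ _ _ _ _ (measurable_trueMean_past b 0)
        (@Measurable.prodMk _ (drawSigma _) _ _ _ _ _ _ (@measurable_const _ _ _ (drawSigma _) _)
          (measurable_posterior_past K hargmax b))
  have hind' : IndepFun (fun ω => M.posterior argmax K ω b) Z M.law :=
    hind.comp (φ := fun x : (A → ℝ) × Unit × Belief A => x.2.2) (by fun_prop) measurable_id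
  let S : (Draw A → ℝ) → A → ℝ := fun ω => beliefPoint (M.posterior argmax K ω b) (Z ω)
  have hS : Measurable S := measurable_beliefPoint.comp (hq.prodMk hZ)
  have hmap : M.law.map S = M.law.map trueMean := hpost.map_sample_eq hZ hlaw hind'
  have haction : ∀ ω, M.action argmax K b k ω = argmax (S ω) := fun ω => rfl
  -- The posterior sample itself becomes the context, so events about the action are determined by
  -- the context.
  have hctx := (hpost.extend_context hZ hind).map_context
    (g := fun x : (Unit × (A → ℝ)) × Belief A => beliefPoint x.2 x.1.2)
    (measurable_beliefPoint.comp (g := fun x : Belief A × (A → ℝ) => beliefPoint x.1 x.2)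
      (f := fun x : (Unit × (A → ℝ)) × Belief A => (x.2, x.1.2)) (by fun_prop))
  have hθint : ∀ i, Integrable (fun ω => trueMean ω i) M.law := fun i =>
    integrable_eval_law M (.prior i)
  have hSint : ∀ i, Integrable (fun ω => S ω i) M.law := fun i => by
    have h1 : Integrable (fun θ : A → ℝ => θ i) (M.law.map trueMean) :=
      (integrable_map_measure (measurable_pi_apply i).aestronglyMeasurable hθ.aemeasurable).2 (hθint i)
    rw [← hmap] at h1
    exact (integrable_map_measure (measurable_pi_apply i).aestronglyMeasurable hS.aemeasurable).1 h1
  have hBint : ∀ i, Integrable (fun ω => √(M.posterior argmax K ω b i).2 * Z ω i) M.law :=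
    fun i => (integrable_eval_law M (.sample b k i)).bdd_mul (c := 1)
      (Measurable.aestronglyMeasurable (by fun_prop)) (.of_forall fun ω => by
        rw [Real.norm_of_nonneg (Real.sqrt_nonneg _)]
        exact sqrt_var_le_one K hprior hnoise hnoise_le ω i b)
  -- The posterior mean is the sample minus its noise term; the sample is integrable because it has
  -- the law of the true mean.
  have hμint : ∀ i, Integrable (fun ω => (M.posterior argmax K ω b i).1) M.law := fun i =>
    ((hSint i).sub (hBint i)).congr (.of_forall fun ω => by simp [S, beliefPoint])
  have hmem : ∀ i, MeasurableSet {x : A → ℝ | i ∈ argmax x} := fun i => by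
    have : {x | i ∈ argmax x} = ⋃ s ∈ {s : Finset A | i ∈ s}, {x | argmax x = s} := by
      ext c; simp
    rw [this]
    exact MeasurableSet.biUnion (Set.to_countable _) fun s _ => hargmax.measurable s
  have hopt : Integrable (fun ω => M.optimalReward (trueMean ω)) M.law := by
    simp_rw [optimalReward_eq hargmax]
    exact integrable_superArmReward_argmax hargmax hθ hθ hθint
  have hplay : Integrable (fun ω => superArmReward (trueMean ω) (M.action argmax K b k ω)) M.law :=
    integrable_superArmReward_argmax hargmax hθ hS hθint
  have hsamp : Integrable (fun ω => superArmReward (S ω) (argmax (S ω))) M.law :=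
    integrable_superArmReward_argmax hargmax hS hS hSint
  have hbonus : ∀ ω, M.samplingBonus argmax K b k ω =
      ∑ i, (S ⁻¹' {x | i ∈ argmax x}).indicator
        (fun ω => √(M.posterior argmax K ω b i).2 * Z ω i) ω := fun ω => by
    simp [samplingBonus, haction, Set.indicator_apply, Z]
  have hbint : ∀ i, Integrable ((S ⁻¹' {x | i ∈ argmax x}).indicator
        (fun ω => √(M.posterior argmax K ω b i).2 * Z ω i)) M.law := fun i =>
    (hBint i).indicator (hS (hmem i))
  have hdiff : ∀ i, Integrable ((S ⁻¹' {x | i ∈ argmax x}).indicator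
        (fun ω => trueMean ω i - (M.posterior argmax K ω b i).1)) M.law := fun i =>
    ((hθint i).sub (hμint i)).indicator (hS (hmem i))
  have hbonus_int : Integrable (M.samplingBonus argmax K b k) M.law := by
    rw [show M.samplingBonus argmax K b k = _ from funext hbonus]
    exact integrable_finsetSum _ fun i _ => hbint i
  refine ⟨hopt.sub hplay, hbonus_int, ?_⟩
  -- Probability matching: both sides integrate the same function against equal laws.
  have hE : ∫ ω, M.optimalReward (trueMean ω) ∂M.law =
      ∫ ω, superArmReward (S ω) (argmax (S ω)) ∂M.law := by
    simp_rw [optimalReward_eq hargmax]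
    have hm : Measurable (fun θ : A → ℝ => superArmReward θ (argmax θ)) :=
      measurable_superArmReward_argmax hargmax measurable_id measurable_id
    rw [← integral_map (φ := S) hS.aemeasurable hm.aestronglyMeasurable, hmap,
      integral_map hθ.aemeasurable hm.aestronglyMeasurable]
  have hzero : ∫ ω, ∑ i, (S ⁻¹' {x | i ∈ argmax x}).indicator
        (fun ω => trueMean ω i - (M.posterior argmax K ω b i).1) ω ∂M.law = 0 := by
    rw [integral_finsetSum _ fun i _ => hdiff i]
    exact Finset.sum_eq_zero fun i _ => hctx.integral_indicator_sub_eq_zero (hmem i) i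
  -- Sample minus truth is sampling noise minus the error of the posterior mean; the latter
  -- integrates to zero on the event that the arm is played.
  have hsplit : ∀ ω, superArmReward (S ω) (argmax (S ω)) -
      superArmReward (trueMean ω) (M.action argmax K b k ω) =
      M.samplingBonus argmax K b k ω - ∑ i, (S ⁻¹' {x | i ∈ argmax x}).indicator
        (fun ω => trueMean ω i - (M.posterior argmax K ω b i).1) ω := fun ω => by
    have hsum : ∀ (f : A → ℝ) (a : Finset A), ∑ i ∈ a, f i = ∑ i, if i ∈ a then f i else 0 :=
      fun f a => by simp
    rw [hbonus, haction, superArmReward, superArmReward, hsum (S ω), hsum (trueMean ω), ← Finset.sum_sub_distrib,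
      ← Finset.sum_sub_distrib]
    refine Finset.sum_congr rfl fun i _ => ?_
    by_cases hi : i ∈ argmax (S ω)
    · have hSi : S ω i = (M.posterior argmax K ω b i).1 +
          √(M.posterior argmax K ω b i).2 * Z ω i := rfl
      have hmemi : ω ∈ S ⁻¹' {x | i ∈ argmax x} := hi
      rw [if_pos hi, if_pos hi, Set.indicator_of_mem hmemi, Set.indicator_of_mem hmemi, hSi]
      ring
    · simp [hi]
  rw [integral_sub hopt hplay, hE, ← integral_sub hsamp hplay]
  simp_rw [hsplit]
  rw [integral_sub hbonus_int (integrable_finsetSum _ fun i _ => hdiff i), hzero, sub_zero]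

end Round

end SemiBandit

/-! ### Summing posterior deviations under batching, and the truncated bound. -/

/-- With steps `0 ≤ m ≤ K`, a sum of `m / √n` in which `n` grows by `m` after each step is within
`K` of the corresponding undelayed sum. -/
lemma sum_div_sqrt_le (m : ℕ → ℝ) {K : ℝ} (hm0 : ∀ b, 0 ≤ m b) (hmK : ∀ b, m b ≤ K) (B : ℕ) :
    ∑ b ∈ Finset.range B, m b / √(1 + ∑ b' ∈ Finset.range b, m b') ≤
      K * (1 - 1 / √(1 + ∑ b ∈ Finset.range B, m b)) +
        2 * (√(1 + ∑ b ∈ Finset.range B, m b) - 1) := by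
  induction B with
  | zero => simp
  | succ B ih =>
    rw [Finset.sum_range_succ, Finset.sum_range_succ m]
    have h0 : 0 ≤ ∑ b ∈ Finset.range B, m b := Finset.sum_nonneg fun b _ => hm0 b
    set n := 1 + ∑ b ∈ Finset.range B, m b with hn
    have hn1 : 1 ≤ n := by linarith
    rw [← add_assoc, ← hn]
    have hx : 0 < √n := Real.sqrt_pos.2 (by linarith)
    have hy : 0 < √(n + m B) := Real.sqrt_pos.2 (by linarith [hm0 B])
    have hxy : √n ≤ √(n + m B) := Real.sqrt_le_sqrt (by linarith [hm0 B])
    have hx2 : √n ^ 2 = n := Real.sq_sqrt (by linarith)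
    have hy2 : √(n + m B) ^ 2 = n + m B := Real.sq_sqrt (by linarith [hm0 B])
    set x := √n
    set y := √(n + m B)
    -- Split `m / x` into `m * (1 / x - 1 / y)`, the price of the delay, and the undelayed term `m /
    -- y`. They are at most `K * (1 / x - 1 / y)` and `2 * (y - x)`, and both bounds telescope.
    have hmB : m B = y ^ 2 - x ^ 2 := by linarith
    have hinv : 0 ≤ 1 / x - 1 / y := sub_nonneg.2 (one_div_le_one_div_of_le hx hxy)
    have h1 : m B * (1 / x - 1 / y) ≤ K * (1 / x - 1 / y) :=
      mul_le_mul_of_nonneg_right (hmK B) hinv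
    have h2 : m B / y ≤ 2 * (y - x) := by
      rw [div_le_iff₀ hy, hmB]
      nlinarith [sq_nonneg (y - x)]
    have h3 : m B / x = m B * (1 / x - 1 / y) + m B / y := by ring
    linarith [ih, h1, h2, h3]

namespace SemiBandit

variable {A : Type*} [Fintype A] [DecidableEq A] {M : SemiBandit A}
  {argmax : (A → ℝ) → Finset A} (K : ℕ)

/-- The variance is frozen within a batch, so a batch contributes its number of plays of the arm
times one standard deviation, which is the setting of `sum_div_sqrt_le`. -/
lemma sum_sqrt_var_le (hprior : ∀ i, 0 < M.priorVar i) (hnoise : ∀ i, 0 < M.noiseVar i)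
    (hnoise_le : ∀ i, M.noiseVar i ≤ 1) (B : ℕ) (ω : Draw A → ℝ) (i : A) :
    ∑ b ∈ Finset.range B, ∑ k ∈ Finset.range K, (if i ∈ M.action argmax K b k ω then
      √(M.posterior argmax K ω b i).2 else 0) ≤ K + 2 * √((B * K : ℕ) : ℝ) := by
  let m : ℕ → ℝ := fun b => ∑ k ∈ Finset.range K,
    if i ∈ M.action argmax K b k ω then (1 : ℝ) else 0
  have hm0 : ∀ b, 0 ≤ m b := fun b => Finset.sum_nonneg fun _ _ => by split_ifs <;> simp
  have hmK : ∀ b, m b ≤ K := fun b => by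
    calc m b ≤ ∑ k ∈ Finset.range K, (1 : ℝ) :=
          Finset.sum_le_sum fun _ _ => by split_ifs <;> simp
      _ = K := by simp
  have hS : ∑ b ∈ Finset.range B, m b ≤ ((B * K : ℕ) : ℝ) := by
    calc ∑ b ∈ Finset.range B, m b ≤ ∑ b ∈ Finset.range B, (K : ℝ) :=
          Finset.sum_le_sum fun b _ => hmK b
      _ = ((B * K : ℕ) : ℝ) := by simp
  have hS0 : 0 ≤ ∑ b ∈ Finset.range B, m b := Finset.sum_nonneg fun b _ => hm0 b
  have h1 : ∑ b ∈ Finset.range B, ∑ k ∈ Finset.range K, (if i ∈ M.action argmax K b k ω then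
      √(M.posterior argmax K ω b i).2 else 0) ≤
      ∑ b ∈ Finset.range B, m b / √(1 + ∑ b' ∈ Finset.range b, m b') := by
    refine Finset.sum_le_sum fun b _ => ?_
    have h := sqrt_var_le (argmax := argmax) K hprior hnoise hnoise_le ω i b
    calc ∑ k ∈ Finset.range K, (if i ∈ M.action argmax K b k ω then
        √(M.posterior argmax K ω b i).2 else 0)
        = m b * √(M.posterior argmax K ω b i).2 := by
          simp only [m, Finset.sum_mul, ite_mul, one_mul, zero_mul]
      _ ≤ m b * (1 / √(1 + ∑ b' ∈ Finset.range b, m b')) :=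
          mul_le_mul_of_nonneg_left h (hm0 b)
      _ = _ := by ring
  refine (h1.trans (sum_div_sqrt_le m hm0 hmK B)).trans ?_
  set n := ∑ b ∈ Finset.range B, m b
  have h2 : (K : ℝ) * (1 - 1 / √(1 + n)) ≤ K * 1 :=
    mul_le_mul_of_nonneg_left (by linarith [one_div_nonneg.2 (Real.sqrt_nonneg (1 + n))])
      (Nat.cast_nonneg K)
  have h3 : √(1 + n) ≤ 1 + √((B * K : ℕ) : ℝ) := by
    rw [Real.sqrt_le_left (by positivity)]
    nlinarith [Real.sq_sqrt (Nat.cast_nonneg (α := ℝ) (B * K)),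
      Real.sqrt_nonneg ((B * K : ℕ) : ℝ)]
  linarith

/-- The Bayesian regret in terms of a truncation level `L` for the standard normal draws. -/
lemma bayesRegret_le_truncation (hprior : ∀ i, 0 < M.priorVar i) (hnoise : ∀ i, 0 < M.noiseVar i)
    (hnoise_le : ∀ i, M.noiseVar i ≤ 1) (hargmax : M.IsArgmax argmax) (B : ℕ) {L : ℝ}
    (hL : 0 ≤ L) :
    Integrable (M.regret argmax B K) M.law ∧
    M.bayesRegret argmax B K ≤
      L * (Fintype.card A * (K + 2 * √((B * K : ℕ) : ℝ))) +
        ((B * K : ℕ) : ℝ) * Fintype.card A * Real.exp ((1 - L ^ 2) / 2) := by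
  have hround := fun b k => integral_regret_round K hprior hnoise hnoise_le hargmax b k
  have hint : ∀ b ∈ Finset.range B, Integrable (fun ω => ∑ k ∈ Finset.range K,
      (M.optimalReward (trueMean ω) - superArmReward (trueMean ω) (M.action argmax K b k ω)))
      M.law := fun b _ => integrable_finsetSum _ fun k _ => (hround b k).1
  refine ⟨integrable_finsetSum _ hint, ?_⟩
  -- This majorant is positive whether or not the arm is played, so the dependence between action
  -- and sample plays no role.
  let e : ℕ → ℕ → A → (Draw A → ℝ) → ℝ := fun b k i ω =>
    Real.exp ((L + 1) * (ω (.sample b k i) - L))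
  have he : ∀ b k i, Integrable (e b k i) M.law ∧
      ∫ ω, e b k i ω ∂M.law = Real.exp ((1 - L ^ 2) / 2) := fun b k i => by
    have hmp := measurePreserving_eval_infinitePi M.drawLaw (.sample b k i)
    have hm : Measurable fun x : ℝ => Real.exp ((L + 1) * (x - L)) := by fun_prop
    have h1 := integral_exp_mul_sub_gaussianReal L
    have hi : Integrable (fun x : ℝ => Real.exp ((L + 1) * (x - L))) (gaussianReal 0 1) := by
      refine Integrable.of_integral_ne_zero ?_
      rw [h1]; exact (Real.exp_pos _).ne'
    refine ⟨hmp.integrable_comp_of_integrable hi, ?_⟩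
    rw [← h1]
    have h2 := integral_map (μ := Measure.infinitePi M.drawLaw) hmp.measurable.aemeasurable
      (f := fun x => Real.exp ((L + 1) * (x - L)))
      hm.aestronglyMeasurable
    rw [hmp.map_eq] at h2
    exact h2.symm
  have hb : M.bayesRegret argmax B K =
      ∫ ω, ∑ b ∈ Finset.range B, ∑ k ∈ Finset.range K, M.samplingBonus argmax K b k ω ∂M.law := by
    unfold bayesRegret regret
    rw [integral_finsetSum _ hint,
      integral_finsetSum _ fun b _ => integrable_finsetSum _ fun k _ => (hround b k).2.1]
    refine Finset.sum_congr rfl fun b _ => ?_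
    rw [integral_finsetSum _ fun k _ => (hround b k).1,
      integral_finsetSum _ fun k _ => (hround b k).2.1]
    exact Finset.sum_congr rfl fun k _ => (hround b k).2.2
  have hesum : ∀ b k, Integrable (fun ω => ∑ i, e b k i ω) M.law :=
    fun b k => integrable_finsetSum _ fun i _ => (he b k i).1
  have hesum' : ∀ b, Integrable (fun ω => ∑ k ∈ Finset.range K, ∑ i, e b k i ω) M.law :=
    fun b => integrable_finsetSum _ fun k _ => hesum b k
  have hesum'' : Integrable (fun ω => ∑ b ∈ Finset.range B, ∑ k ∈ Finset.range K,
      ∑ i, e b k i ω) M.law := integrable_finsetSum _ fun b _ => hesum' b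
  have hpt : ∀ ω, ∑ b ∈ Finset.range B, ∑ k ∈ Finset.range K, M.samplingBonus argmax K b k ω ≤
      L * (Fintype.card A * (K + 2 * √((B * K : ℕ) : ℝ))) +
        ∑ b ∈ Finset.range B, ∑ k ∈ Finset.range K, ∑ i, e b k i ω := fun ω => by
    have h1 : ∀ b k, M.samplingBonus argmax K b k ω ≤
        (∑ i, L * (if i ∈ M.action argmax K b k ω then √(M.posterior argmax K ω b i).2 else 0)) +
          ∑ i, e b k i ω := fun b k => by
      rw [samplingBonus, ← Finset.sum_add_distrib]
      refine Finset.sum_le_sum fun i _ => ?_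
      have hpos : 0 < e b k i ω := Real.exp_pos _
      split_ifs
      · set s := √(M.posterior argmax K ω b i).2
        have hs0 : 0 ≤ s := Real.sqrt_nonneg _
        have hs1 : s ≤ 1 := sqrt_var_le_one K hprior hnoise hnoise_le ω i b
        set z := ω (.sample b k i)
        have hexp : (L + 1) * (z - L) + 1 ≤ e b k i ω := Real.add_one_le_exp _
        -- Below `L` the term is at most `s * L`. Above it, `s * (z - L) ≤ z - L ≤ (L + 1) * (z - L)
        -- + 1`, using `s ≤ 1`.
        rcases le_total z L with hz | hz
        · nlinarith
        · nlinarith [mul_nonneg (sub_nonneg.2 hs1) (sub_nonneg.2 hz),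
            mul_nonneg hL (sub_nonneg.2 hz)]
      · simpa using hpos.le
    calc ∑ b ∈ Finset.range B, ∑ k ∈ Finset.range K, M.samplingBonus argmax K b k ω
        ≤ ∑ b ∈ Finset.range B, ∑ k ∈ Finset.range K, ((∑ i, L *
          (if i ∈ M.action argmax K b k ω then √(M.posterior argmax K ω b i).2 else 0)) +
          ∑ i, e b k i ω) :=
          Finset.sum_le_sum fun b _ => Finset.sum_le_sum fun k _ => h1 b k
      _ = L * ∑ i, ∑ b ∈ Finset.range B, ∑ k ∈ Finset.range K,
          (if i ∈ M.action argmax K b k ω then √(M.posterior argmax K ω b i).2 else 0) +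
          ∑ b ∈ Finset.range B, ∑ k ∈ Finset.range K, ∑ i, e b k i ω := by
          simp only [Finset.sum_add_distrib]
          congr 1
          rw [Finset.sum_comm]
          simp only [Finset.mul_sum]
          rw [Finset.sum_comm]
          conv_rhs => rw [Finset.sum_comm]
          exact Finset.sum_congr rfl fun b _ => Finset.sum_comm
      _ ≤ L * ∑ i : A, (K + 2 * √((B * K : ℕ) : ℝ)) +
          ∑ b ∈ Finset.range B, ∑ k ∈ Finset.range K, ∑ i, e b k i ω := by
          gcongr with i
          exact sum_sqrt_var_le K hprior hnoise hnoise_le B ω i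
      _ = _ := by rw [Finset.sum_const, Finset.card_univ, nsmul_eq_mul]
  rw [hb]
  refine (integral_mono (integrable_finsetSum _ fun b _ => integrable_finsetSum _ fun k _ =>
    (hround b k).2.1) ((integrable_const _).add hesum'') hpt).trans (le_of_eq ?_)
  simp only [Pi.add_apply]
  rw [integral_add (integrable_const _) hesum'', integral_const, probReal_univ, one_smul,
    integral_finsetSum _ fun b _ => hesum' b]
  congr 1
  simp_rw [integral_finsetSum _ fun k _ => hesum _ k, integral_finsetSum _ fun i _ => (he _ _ i).1,
    (he _ _ _).2]
  simp
  ring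

end SemiBandit

/-! ### Choice of the truncation level and the numerical constants. -/

theorem mainTheorem1 {A : Type*} [Fintype A] [DecidableEq A] (M : SemiBandit A)
    (hprior : ∀ i, 0 < M.priorVar i) (hnoise : ∀ i, 0 < M.noiseVar i)
    (hnoise_le : ∀ i, M.noiseVar i ≤ 1)
    (argmax : (A → ℝ) → Finset A) (hargmax : M.IsArgmax argmax)
    (T B K : ℕ) (hT : T = B * K) (hA : Fintype.card A ≤ T) :
    Integrable (M.regret argmax B K) M.law ∧
    M.bayesRegret argmax B K ≤
      4 + 4 * √(8 * Real.log T) * ((Fintype.card A : ℝ) * K + (Fintype.card A : ℝ) * √T) ∧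
    (2 ≤ T → M.bayesRegret argmax B K ≤
      16 * √(Real.log T) * ((Fintype.card A : ℝ) * K + (Fintype.card A : ℝ) * √T)) := by
  have hlog : 0 ≤ Real.log T := Real.log_natCast_nonneg T
  obtain ⟨hint, hle⟩ := SemiBandit.bayesRegret_le_truncation K hprior hnoise hnoise_le hargmax B
    (Real.sqrt_nonneg (8 * Real.log T))
  rw [← hT, Real.sq_sqrt (by positivity)] at hle
  set L := √(8 * Real.log T) with hLdef
  have hL : 0 ≤ L := Real.sqrt_nonneg _
  set N := (Fintype.card A : ℝ)
  have hN : 0 ≤ N := Nat.cast_nonneg _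
  have hNT : N ≤ T := Nat.cast_le.2 hA
  have hK : (0 : ℝ) ≤ K := Nat.cast_nonneg _
  have hsT : 0 ≤ √(T : ℝ) := Real.sqrt_nonneg _
  have hmain : L * (N * (K + 2 * √T)) ≤ 2 * L * (N * K + N * √T) := by
    have := mul_nonneg hL (mul_nonneg hN hK)
    linarith
  -- the contribution of the draws above the truncation level
  have htail : (T : ℝ) * N * Real.exp ((1 - 8 * Real.log T) / 2) ≤ 2 * N ∧
      (T : ℝ) * N * Real.exp ((1 - 8 * Real.log T) / 2) ≤ 2 := by
    rcases Nat.eq_zero_or_pos T with h0 | h0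
    -- For `T = 0` the exponential is not small, but there are no base arms.
    · have : N = 0 := le_antisymm (by simpa [h0] using hNT) hN
      simp [this]
    have hT1 : (1 : ℝ) ≤ T := by exact_mod_cast h0
    have hT0 : (0 : ℝ) < T := by linarith
    -- The constant `8` yields a factor `T⁻⁴`, more than enough to beat `T * N ≤ T ^ 2`.
    have hexp : Real.exp ((1 - 8 * Real.log T) / 2) = Real.exp (1 / 2) / (T : ℝ) ^ 4 := by
      rw [show (1 - 8 * Real.log T) / 2 = 1 / 2 - (4 : ℕ) * Real.log T by push_cast; ring,
        Real.exp_sub, Real.exp_nat_mul, Real.exp_log hT0]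
    have he : Real.exp (1 / 2) ≤ 2 := by
      have h := Real.exp_one_lt_d9
      have h2 : Real.exp (1 / 2) ^ 2 = Real.exp 1 := by
        rw [← Real.exp_nat_mul]; norm_num
      nlinarith [Real.exp_pos (1 / 2)]
    have h2 : (T : ℝ) ^ 2 ≤ T ^ 4 := pow_le_pow_right₀ hT1 (by norm_num)
    have h1 : (T : ℝ) ≤ T ^ 4 := le_self_pow₀ hT1 (by norm_num)
    have hp : (0 : ℝ) < T ^ 4 := by positivity
    rw [hexp, mul_div_assoc', div_le_iff₀ hp, div_le_iff₀ hp]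
    constructor
    · calc (T : ℝ) * N * Real.exp (1 / 2) ≤ T ^ 4 * N * 2 := by gcongr
        _ = 2 * N * T ^ 4 := by ring
    · calc (T : ℝ) * N * Real.exp (1 / 2) ≤ T * T * 2 := by gcongr
        _ = 2 * T ^ 2 := by ring
        _ ≤ 2 * T ^ 4 := by gcongr
  have hS : 0 ≤ N * K + N * √T := by positivity
  refine ⟨hint, ?_, fun h2 => ?_⟩
  · have := mul_nonneg hL hS
    linarith [htail.2]
  -- Here the tail bound `2 * N` is used instead of `2`: with no additive constant allowed, the tail
  -- must be absorbed into `N * K + N * √T`, which vanishes when there are no arms.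
  · have hl2 : (1 / 2 : ℝ) ≤ Real.log T := by
      have h1 : Real.log 2 ≤ Real.log T :=
        Real.log_le_log (by norm_num) (by exact_mod_cast h2)
      linarith [Real.log_two_gt_d9]
    have hl : (1 / 2 : ℝ) ≤ √(Real.log T) :=
      Real.le_sqrt_of_sq_le (by linarith)
    have hL3 : L ≤ 3 * √(Real.log T) := by
      rw [hLdef, Real.sqrt_mul (by norm_num)]
      gcongr
      rw [Real.sqrt_le_left (by norm_num)]
      norm_num
    have hT1 : (1 : ℝ) ≤ √T := by
      rw [Real.one_le_sqrt]
      exact_mod_cast (by omega : 1 ≤ T)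
    have hNS : N ≤ N * K + N * √T := by
      nlinarith [mul_nonneg hN hK, mul_nonneg hN (sub_nonneg.2 hT1)]
    have e1 : 2 * L * (N * K + N * √T) ≤ 2 * (3 * √(Real.log T)) * (N * K + N * √T) := by gcongr
    have e2 : 1 / 2 * (N * K + N * √T) ≤ √(Real.log T) * (N * K + N * √T) := by gcongr
    linarith [htail.1]
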